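/- Let $n\ge 1$, let $M_n(\mathbb{R})$ be the set of real $n\times n$ matrices, and let $G\subset M_n(\mathbb{R})$ be an abelian (commutative) semigroup under matrix multiplication that is generated by at most $\left[\frac{n+1}{2}\right]$ matrices of $M_n(\mathbb{R})$, where $[\,\cdot\,]$ denotes the integer part (the matrices need not be invertible, and it does not matter whether the identity matrix, as the empty product, is counted in $G$). Then for every $v\in\mathbb{R}^n$ the orbit $G(v)=\{Mv : M\in G\}$ is nowhere dense in $\mathbb{R}^n$, i.e. its closure has empty interior. Equivalently, $G$ has no locally dense orbit (an orbit whose closure has nonempty interior); in particular $G$ is not hypercyclic, i.e. there is no $v\in\mathbb{R}^n$ for which $G(v)$ is dense in $\mathbb{R}^n$. -/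

import Mathlib

namespace MatrixSemigroup

/-- The semigroup `G` of real square matrices is generated by the finite family `A`. Both usual
conventions are admitted: the empty product (the identity matrix) may be left out or included. -/
def IsGeneratedBy {n p : ℕ} (G : Subsemigroup (Matrix (Fin n) (Fin n) ℝ))
    (A : Fin p → Matrix (Fin n) (Fin n) ℝ) : Prop :=
  G = Subsemigroup.closure (Set.range A) ∨
    G = (Submonoid.closure (Set.range A)).toSubsemigroup

/-- `G` is abelian: any two of its elements commute. -/
def IsAbelian {n : ℕ} (G : Subsemigroup (Matrix (Fin n) (Fin n) ℝ)) : Prop :=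
  ∀ M ∈ G, ∀ N ∈ G, M * N = N * M

/-- The orbit `G(v) = {M v : M ∈ G}`. -/
def orbit {n : ℕ} (G : Subsemigroup (Matrix (Fin n) (Fin n) ℝ)) (v : Fin n → ℝ) :
    Set (Fin n → ℝ) :=
  {w | ∃ M ∈ G, w = M.mulVec v}

/-- `G` has a locally dense orbit: one whose closure has nonempty interior. -/
def IsLocallyHypercyclic {n : ℕ} (G : Subsemigroup (Matrix (Fin n) (Fin n) ℝ)) : Prop :=
  ∃ v : Fin n → ℝ, (interior (closure (orbit G v))).Nonempty

/-- `G` has a dense orbit. -/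
def IsHypercyclic {n : ℕ} (G : Subsemigroup (Matrix (Fin n) (Fin n) ℝ)) : Prop :=
  ∃ v : Fin n → ℝ, Dense (orbit G v)

end MatrixSemigroup

/-! Suppose the orbit of `v` is somewhere dense. On the commutative algebra `R` spanned by products
of the generators, evaluation at `v` is then onto, and by commutativity injective, so `dim R = n`
and the question concerns a multiplicative semigroup with `p` generators inside `R`. Near a unit of
the semigroup, the open map `exp` pulls it back into the additive group `D` of logarithms of the
group generated by the unit generators. The kernel of `exp` embeds in `ℤ ^ c`, with `c` the number
of conjugate pairs of nonreal characters, so `2 * c ≤ n` and `D` has rank at most `p + c ≤ n`. Such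
a group lies in a proper subspace or is a lattice, hence is nowhere dense. -/

open NormedSpace Set Topology Module

/-! ### Ranks of additive subgroups -/

/-- A finitely generated additive subgroup of a nontrivial real vector space whose rank does not
exceed the dimension of the space is nowhere dense. -/
theorem isNowhereDense_of_finrank_int_le {E : Type*} [NormedAddCommGroup E] [NormedSpace ℝ E]
    [FiniteDimensional ℝ E] [Nontrivial E] (D : Submodule ℤ E) [Module.Finite ℤ D]
    (h : finrank ℤ D ≤ finrank ℝ E) : IsNowhereDense (D : Set E) := by
  have : IsAddTorsionFree E := 
    let : Module ℚ E := Module.compHom E (algebraMap ℚ ℝ)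
    IsAddTorsionFree.of_module_rat E
  let b := Module.finBasis ℤ D
  let v : Fin (finrank ℤ D) → E := fun i => (b i : E)
  have hD : Submodule.span ℤ (range v) = D := by
    have : range v = D.subtype '' range b := by rw [← range_comp]; rfl
    rw [this, Submodule.span_image, b.span_eq, Submodule.map_top, Submodule.range_subtype]
  have hsub : (D : Set E) ⊆ (Submodule.span ℝ (range v) : Set E) := by
    have h1 := Submodule.span_subset_span ℤ ℝ (range v)
    rwa [hD] at h1
  -- If `D` spans, the rank bound makes its `ℤ`-basis a real basis and `D` a lattice, closed and
  -- countable. Otherwise `D` lies in a proper closed subspace.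
  by_cases htop : Submodule.span ℝ (range v) = ⊤
  · have hcard : Fintype.card (Fin (finrank ℤ D)) = finrank ℝ E := by
      refine le_antisymm (by simpa using h) ?_
      have := finrank_range_le_card (R := ℝ) v
      rwa [Set.finrank, htop, finrank_top] at this
    have hli : LinearIndependent ℝ v :=
      linearIndependent_of_top_le_span_of_card_eq_finrank htop.ge hcard
    let B := Basis.mk hli htop.ge
    have hB : Submodule.span ℤ (range B) = D := by rw [Basis.coe_mk, hD]
    have hdisc : DiscreteTopology (Submodule.span ℤ (range B)).toAddSubgroup := inferInstance
    have hcl : IsClosed (D : Set E) := by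
      rw [← hB]
      exact AddSubgroup.isClosed_of_discrete (H := (Submodule.span ℤ (range B)).toAddSubgroup)
    have hct : (D : Set E).Countable := by
      rw [← hB]
      exact (inferInstance : Countable (Submodule.span ℤ (range B))).to_set
    rw [IsNowhereDense, hcl.closure_eq, interior_eq_empty_iff_dense_compl]
    exact hct.dense_compl ℝ
  · rw [IsNowhereDense, ← not_nonempty_iff_eq_empty]
    intro hne
    apply htop
    refine Submodule.eq_top_of_nonempty_interior' _ (hne.mono (interior_mono ?_))
    exact closure_minimal hsub (Submodule.closed_of_finiteDimensional _)

/-- If the kernel of a map `D → M` of modules embeds in `N`, the rank of `D` is at most the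
sum of the ranks of `M` and `N`. -/
theorem finite_and_finrank_le_of_ker {A D M N : Type*} [CommRing A] [IsDomain A]
    [AddCommGroup D] [Module A D] [AddCommGroup M] [Module A M] [AddCommGroup N] [Module A N]
    [IsNoetherian A M] [IsNoetherian A N] (f : D →ₗ[A] M)
    (g : LinearMap.ker f →ₗ[A] N) (hg : Function.Injective g) :
    Module.Finite A D ∧ finrank A D ≤ finrank A M + finrank A N := by
  have : IsNoetherian A (LinearMap.ker f) := isNoetherian_of_injective g hg
  have : IsNoetherian A D :=
    isNoetherian_of_range_eq_ker (LinearMap.ker f).subtype f (by simp)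
  refine ⟨inferInstance, ?_⟩
  have hsum : finrank A (LinearMap.range f) + finrank A (LinearMap.ker f) = finrank A D :=
    f.quotKerEquivRange.finrank_eq ▸ (LinearMap.ker f).finrank_quotient_add_finrank
  rw [← hsum]
  exact add_le_add (Submodule.finrank_le _) (LinearMap.finrank_le_finrank_of_injective hg)

/-! ### Units, exponential and characters of a commutative algebra -/

section

variable {R : Type*} [NormedCommRing R] [NormedAlgebra ℝ R] [FiniteDimensional ℝ R]

/-- `x - t` is a unit unless `t` is one of the finitely many roots of the minimal polynomial of `x`;
let `t` tend to `0`. -/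
theorem dense_setOf_isUnit : Dense {x : R | IsUnit x} := by
  have := FiniteDimensional.complete ℝ R
  intro x
  have hfin : (spectrum ℝ x).Finite := by
    refine ((minpoly ℝ x).rootSet_finite ℝ).subset fun t ht => ?_
    have h0 := minpoly.ne_zero (Algebra.IsIntegral.isIntegral (R := ℝ) x)
    rw [Polynomial.mem_rootSet]
    refine ⟨h0, ?_⟩
    have := spectrum.subset_polynomial_aeval x (minpoly ℝ x) ⟨t, ht, rfl⟩
    rw [minpoly.aeval] at this
    rcases subsingleton_or_nontrivial R with hR | hR
    · simp at this
    · simpa using this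
  have hd : Dense ((spectrum ℝ x)ᶜ) := hfin.countable.dense_compl ℝ
  have h0 : (0 : ℝ) ∈ closure ((spectrum ℝ x)ᶜ) := hd 0
  have hc : Continuous fun t : ℝ => x - algebraMap ℝ R t := by fun_prop
  have := image_closure_subset_closure_image hc ⟨0, h0, rfl⟩
  simp only [map_zero, sub_zero] at this
  refine closure_mono ?_ this
  rintro _ ⟨t, ht, rfl⟩
  have := spectrum.notMem_iff.1 ht
  simpa using this.neg

/-- The derivative at `x` is multiplication by the unit `exp x`, hence onto. -/
theorem isOpenMap_exp : IsOpenMap (exp : R → R) := by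
  have := FiniteDimensional.complete ℝ R
  let : NormedAlgebra ℚ R := NormedAlgebra.restrictScalars ℚ ℝ R
  rw [isOpenMap_iff_nhds_le]
  intro x
  refine ((hasStrictFDerivAt_exp (𝕂 := ℝ) (x := x)).map_nhds_eq_of_surj ?_).ge
  rw [LinearMap.range_eq_top]
  intro y
  obtain ⟨u, hu⟩ := isUnit_exp x
  refine ⟨(↑u⁻¹ : R) * y, ?_⟩
  simp [← hu]

theorem mul_exp_of_mul_sq_eq_zero {x y : R} (h : y * x ^ 2 = 0) :
    y * exp x = y + y * x := by
  have := FiniteDimensional.complete ℝ R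
  have hs := expSeries_summable' (𝕂 := ℝ) x
  rw [exp_eq_tsum ℝ]
  beta_reduce
  rw [← hs.sum_add_tsum_nat_add 2, mul_add, ← Summable.tsum_mul_left]
  · have : ∀ n : ℕ, y * (((n + 2).factorial⁻¹ : ℝ) • x ^ (n + 2)) = 0 := fun n => by
      rw [mul_smul_comm, pow_add, mul_comm (x ^ n), ← mul_assoc, h, zero_mul, smul_zero]
    simp [this, Finset.sum_range_succ, mul_add]
  · exact (summable_nat_add_iff 2).2 hs

/-- If `x ≠ 0` has nilpotency class `m + 2`, multiplying `exp x = 1` by `x ^ m` leaves `x ^ m + x ^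
(m + 1) = x ^ m`, so `x ^ (m + 1) = 0`, a contradiction. -/
theorem eq_zero_of_isNilpotent_of_exp_eq_one {x : R} (hx : IsNilpotent x) (h : exp x = 1) :
    x = 0 := by
  rcases subsingleton_or_nontrivial R with hR | hR
  · exact Subsingleton.elim _ _
  by_contra hne
  obtain ⟨m, hm⟩ : ∃ m, nilpotencyClass x = m + 2 := by
    have h0 : nilpotencyClass x ≠ 0 := (pos_nilpotencyClass_iff.2 hx).ne'
    have h1 : nilpotencyClass x ≠ 1 := fun h => hne (nilpotencyClass_eq_one.1 h)
    exact ⟨nilpotencyClass x - 2, by omega⟩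
  obtain ⟨h1, h2⟩ := nilpotencyClass_eq_succ_iff.1 hm
  have := mul_exp_of_mul_sq_eq_zero (x := x) (y := x ^ m) (by rw [← pow_add]; exact h1)
  rw [h, mul_one, left_eq_add, ← pow_succ] at this
  exact h2 this

/-- The complex characters of a finite-dimensional commutative real algebra detect nilpotency. -/
theorem isNilpotent_of_forall_algHom {A : Type*} [CommRing A] [Algebra ℝ A]
    [FiniteDimensional ℝ A] {x : A} (h : ∀ φ : A →ₐ[ℝ] ℂ, φ x = 0) : IsNilpotent x := by
  rw [← mem_nilradical, nilradical_eq_sInf, Submodule.mem_sInf]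
  intro (P : Ideal A) (hP : P.IsPrime)
  have : IsArtinianRing A := IsArtinianRing.of_finite ℝ A
  have : P.IsMaximal := IsArtinianRing.isMaximal_of_isPrime P
  let := Ideal.Quotient.field P
  let ψ : (A ⧸ P) →ₐ[ℝ] ℂ := IsAlgClosed.lift
  have h1 := h (ψ.comp (Ideal.Quotient.mkₐ ℝ P))
  rw [AlgHom.comp_apply, map_eq_zero] at h1
  exact Ideal.Quotient.eq_zero_iff_mem.1 h1

/-- The exponential of a finite-dimensional commutative algebra as a homomorphism to its units. -/
noncomputable def expUnits (R : Type*) [NormedCommRing R] [NormedAlgebra ℝ R]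
    [FiniteDimensional ℝ R] : R →ₗ[ℤ] Additive Rˣ :=
  haveI := FiniteDimensional.complete ℝ R
  letI : NormedAlgebra ℚ R := NormedAlgebra.restrictScalars ℚ ℝ R
  (MonoidHom.toAdditiveRight (MonoidHom.toHomUnits (G := Multiplicative R) (M := R)
    { toFun := fun x => exp x.toAdd
      map_one' := by simp
      map_mul' := fun x y => by simp [exp_add] })).toIntLinearMap

theorem coe_expUnits (x : R) : ((expUnits R x).toMul : R) = exp x := rfl

theorem expUnits_eq_zero_iff {x : R} : expUnits R x = 0 ↔ exp x = 1 := by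
  rw [← coe_expUnits, Units.val_eq_one]
  rfl

/-- Half of the nonreal characters: one of each pair of complex conjugates. -/
theorem exists_conj_representatives (A : Type*) [CommRing A] [Algebra ℝ A]
    [FiniteDimensional ℝ A] : ∃ T : Finset (A →ₐ[ℝ] ℂ), 2 * T.card ≤ finrank ℝ A ∧
      ∀ x : A, (∀ φ : A →ₐ[ℝ] ℂ, (φ x).re = 0) → (∀ φ ∈ T, φ x = 0) →
        ∀ φ : A →ₐ[ℝ] ℂ, φ x = 0 := by
  classical
  have := Fintype.ofFinite (A →ₐ[ℝ] ℂ)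
  let e := Fintype.equivFin (A →ₐ[ℝ] ℂ)
  let σ : (A →ₐ[ℝ] ℂ) → (A →ₐ[ℝ] ℂ) := fun φ => Complex.conjAe.toAlgHom.comp φ
  have hσ : ∀ φ x, σ φ x = (starRingEnd ℂ) (φ x) := fun φ x => rfl
  have hσσ : Function.Involutive σ := fun φ => by ext x; simp [hσ]
  -- An arbitrary enumeration selects one of each conjugate pair; the strict inequality discards
  -- real characters, which `σ` fixes.
  let T : Finset (A →ₐ[ℝ] ℂ) := {φ | e φ < e (σ φ)}
  refine ⟨T, ?_, fun x hre hT φ => ?_⟩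
  · have hdisj : Disjoint T (T.image σ) := by
      rw [Finset.disjoint_left]
      intro φ h1 h2
      obtain ⟨ψ, hψ, rfl⟩ := Finset.mem_image.1 h2
      simp only [T, Finset.mem_filter_univ, hσσ ψ] at h1 hψ
      exact lt_asymm h1 hψ
    calc 2 * T.card = (T ∪ T.image σ).card := by
          rw [Finset.card_union_of_disjoint hdisj, Finset.card_image_of_injective _ hσσ.injective,
            two_mul]
      _ ≤ Fintype.card (A →ₐ[ℝ] ℂ) := Finset.card_le_univ _
      _ ≤ finrank ℝ A := by
          rw [← Nat.card_eq_fintype_card]; exact card_algHom_le_finrank ℝ A ℂ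
  · rcases lt_trichotomy (e φ) (e (σ φ)) with h | h | h
    · exact hT φ (by simpa [T] using h)
    · have h1 : φ x = (starRingEnd ℂ) (φ x) := by rw [← hσ, ← e.injective h]
      have h2 := Complex.conj_eq_iff_im.1 h1.symm
      exact Complex.ext (hre φ) h2
    · have h1 : σ φ x = 0 := hT _ (by simpa [T, hσσ φ] using h)
      rw [hσ] at h1
      simpa using h1

theorem exp_algHom_eq_one {x : R} (hx : exp x = 1) (φ : R →ₐ[ℝ] ℂ) :
    ∃ k : ℤ, φ x = k * (2 * Real.pi * Complex.I) := by
  have := FiniteDimensional.complete ℝ R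
  let : NormedAlgebra ℚ R := NormedAlgebra.restrictScalars ℚ ℝ R
  have hc : Continuous φ := φ.toLinearMap.continuous_of_finiteDimensional
  rw [← Complex.exp_eq_one_iff, Complex.exp_eq_exp_ℂ, ← map_exp φ hc, hx, map_one]

/-- The kernel of the exponential embeds in `ℤ ^ c`, where `c` is the number of pairs of conjugate
nonreal characters. -/
theorem exists_injective_ker_expUnits (R : Type*) [NormedCommRing R] [NormedAlgebra ℝ R]
    [FiniteDimensional ℝ R] : ∃ (c : ℕ) (g : LinearMap.ker (expUnits R) →ₗ[ℤ] (Fin c → ℤ)),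
      2 * c ≤ finrank ℝ R ∧ Function.Injective g := by
  obtain ⟨T, hcard, hT⟩ := exists_conj_representatives R
  have hk (x : LinearMap.ker (expUnits R)) (φ : R →ₐ[ℝ] ℂ) :=
    exp_algHom_eq_one (expUnits_eq_zero_iff.1 x.2) φ
  choose k hk using hk
  have hne : (2 * Real.pi * Complex.I : ℂ) ≠ 0 := Complex.two_pi_I_ne_zero
  refine ⟨T.card, AddMonoidHom.toIntLinearMap
    (AddMonoidHom.mk' (fun x i => k x (T.equivFin.symm i)) fun x y => funext fun i => ?_),
    hcard, ?_⟩
  · have h : ((k (x + y) (T.equivFin.symm i) : ℤ) : ℂ) * (2 * Real.pi * Complex.I) =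
        (k x (T.equivFin.symm i) + k y (T.equivFin.symm i) : ℤ) * (2 * Real.pi * Complex.I) := by
      rw [Int.cast_add, add_mul, ← hk, ← hk, ← hk, Submodule.coe_add, map_add]
    exact_mod_cast mul_right_cancel₀ hne h
  -- All character values are purely imaginary, so vanishing on `T` forces vanishing everywhere; `x`
  -- is then nilpotent with `exp x = 1`.
  · rw [injective_iff_map_eq_zero]
    intro x hx
    have hx0 : ∀ φ ∈ T, φ (x : R) = 0 := fun φ hφ => by
      have := congrFun hx (T.equivFin ⟨φ, hφ⟩)
      simp only [AddMonoidHom.coe_toIntLinearMap, AddMonoidHom.mk'_apply,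
        Equiv.symm_apply_apply, Pi.zero_apply] at this
      rw [hk, this, Int.cast_zero, zero_mul]
    have hre : ∀ φ : R →ₐ[ℝ] ℂ, (φ x).re = 0 := fun φ => by simp [hk]
    exact Subtype.ext (eq_zero_of_isNilpotent_of_exp_eq_one
      (isNilpotent_of_forall_algHom (hT x hre hx0)) (expUnits_eq_zero_iff.1 x.2))

/-! ### Semigroups in a commutative algebra -/

/-- Logarithms of a group of units of rank `p` form a nowhere dense subgroup if `p` is small. -/
theorem isNowhereDense_comap_expUnits [Nontrivial R] {p : ℕ} (hp : 2 * p ≤ finrank ℝ R + 1)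
    (u : Fin p → Rˣ) :
    IsNowhereDense ((LinearMap.range (Fintype.linearCombination ℤ
      fun i => Additive.ofMul (u i))).comap (expUnits R) : Set R) := by
  set H := LinearMap.range (Fintype.linearCombination ℤ fun i => Additive.ofMul (u i))
  obtain ⟨c, g, hc, hg⟩ := exists_injective_ker_expUnits R
  let D := H.comap (expUnits R)
  let f : D →ₗ[ℤ] H := (expUnits R).restrict fun x hx => hx
  let ι : LinearMap.ker f →ₗ[ℤ] LinearMap.ker (expUnits R) :=
    (D.subtype ∘ₗ (LinearMap.ker f).subtype).codRestrict _ fun x => by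
      have := congrArg Subtype.val (LinearMap.mem_ker.1 x.2)
      exact this
  have hι : Function.Injective ι := fun x y h =>
    Subtype.ext (Subtype.ext (congrArg (fun z : LinearMap.ker (expUnits R) => (z : R)) h))
  obtain ⟨hfin, hrank⟩ := finite_and_finrank_le_of_ker f (g ∘ₗ ι) (hg.comp hι)
  have hH : finrank ℤ H ≤ p := by
    simpa using LinearMap.finrank_range_le
      (Fintype.linearCombination ℤ fun i => Additive.ofMul (u i))
  refine isNowhereDense_of_finrank_int_le D ?_
  rw [finrank_fin_fun] at hrank
  -- With `d = finrank ℝ R`, `2 * p ≤ d + 1` and `2 * c ≤ d` give `2 * (p + c) ≤ 2 * d + 1`, so `p +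
  -- c ≤ d` by parity.
  omega

/-- A commutative real algebra of dimension `n` has no somewhere dense multiplicative semigroup with
`[(n + 1) / 2]` generators. -/
theorem isNowhereDense_closure_range [Nontrivial R] {p : ℕ} (hp : 2 * p ≤ finrank ℝ R + 1)
    (a : Fin p → R) : IsNowhereDense (Submonoid.closure (range a) : Set R) := by
  classical
  have := FiniteDimensional.complete ℝ R
  let : NormedAlgebra ℚ R := NormedAlgebra.restrictScalars ℚ ℝ R
  set S : Set R := ((Submonoid.closure (range a) : Submonoid R) : Set R)
  -- The default `1` is harmless: a product is a unit only if every factor is, so units of `S`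
  -- involve unit generators only.
  let u : Fin p → Rˣ := fun i => if h : IsUnit (a i) then h.unit else 1
  let Φ := Fintype.linearCombination ℤ fun i => Additive.ofMul (u i)
  let D := (LinearMap.range Φ).comap (expUnits R)
  have hmem : ∀ s ∈ S, ∀ w : Rˣ, (w : R) = s → Additive.ofMul w ∈ LinearMap.range Φ := by
    intro s hs
    induction hs using Submonoid.closure_induction with
    | mem x hx =>
      obtain ⟨i, rfl⟩ := hx
      intro w hw
      refine ⟨Pi.single i 1, ?_⟩
      have hu : IsUnit (a i) := hw ▸ w.isUnit
      have : u i = w := Units.ext (by simp [u, hu, hw])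
      simp [Φ, Fintype.linearCombination_apply_single, this]
    | one => intro w hw; rw [Units.val_eq_one.1 hw]; exact zero_mem _
    | mul x y _ _ hx hy =>
      intro w hw
      obtain ⟨⟨x', rfl⟩, ⟨y', rfl⟩⟩ := (IsUnit.mul_iff (x := x) (y := y)).1 (hw ▸ w.isUnit)
      have : w = x' * y' := Units.ext hw
      rw [this, ofMul_mul]
      exact add_mem (hx x' rfl) (hy y' rfl)
  rw [IsNowhereDense, ← not_nonempty_iff_eq_empty]
  intro hne
  obtain ⟨_, hgU, ⟨g, rfl⟩⟩ := dense_setOf_isUnit.inter_open_nonempty _ isOpen_interior hne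
  have hopen (w : Rˣ) : IsOpenMap fun x : R => (w : R) * exp x :=
    (isOpenMap_smul w).comp isOpenMap_exp
  have hmeet (w : Rˣ) {N : Set R} (hN : IsOpen N) {x : R} (hx : x ∈ N)
      (hxU : (w : R) * exp x ∈ interior (closure S)) : ∃ y ∈ N, (w : R) * exp y ∈ S ∧
        (w : R) * exp y ∈ interior (closure S) := by
    obtain ⟨_, ⟨⟨y, hy, rfl⟩, hyU⟩, hyS⟩ := mem_closure_iff.1 (interior_subset hxU) _
      ((hopen w N hN).inter isOpen_interior) ⟨⟨x, hx, rfl⟩, hxU⟩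
    exact ⟨y, hy, hyS, hyU⟩
  -- The unit `g` need not lie in `S`. It is moved to a unit `w` in `S`, so that `w * exp z ∈ S`
  -- puts `z` in `D`.
  obtain ⟨y, -, hyS, hyU⟩ := hmeet g isOpen_univ (mem_univ 0) (by simpa using hgU)
  let w : Rˣ := g * (expUnits R y).toMul
  have hw : (w : R) = (g : R) * exp y := rfl
  rw [← hw] at hyS hyU
  have hcont : Continuous fun x : R => (w : R) * exp x := continuous_const.mul exp_continuous
  have hsub : (fun x : R => (w : R) * exp x) ⁻¹' interior (closure S) ⊆ closure (D : Set R) := by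
    intro x hx
    rw [mem_closure_iff]
    intro N hN hxN
    obtain ⟨z, hzN, hzS, -⟩ := hmeet w hN hxN hx
    refine ⟨z, hzN, ?_⟩
    have h1 := hmem _ hzS (w * (expUnits R z).toMul) rfl
    rw [ofMul_mul] at h1
    exact (Submodule.add_mem_iff_right _ (hmem _ hyS w rfl)).1 h1
  have h0 : (0 : R) ∈ interior (closure (D : Set R)) :=
    interior_maximal hsub (isOpen_interior.preimage hcont) (by simpa using hyU)
  rw [show interior (closure (D : Set R)) = ∅ from isNowhereDense_comap_expUnits hp u] at h0
  exact h0

end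

/-! ### Transfer to matrices and orbits -/

theorem isNowhereDense_linearEquiv_image_closure_range {R E : Type*} [NormedCommRing R]
    [NormedAlgebra ℝ R] [NormedAddCommGroup E] [NormedSpace ℝ E] [FiniteDimensional ℝ E]
    [Nontrivial E] (e : R ≃ₗ[ℝ] E) {p : ℕ} (hp : 2 * p ≤ finrank ℝ E + 1) (a : Fin p → R) :
    IsNowhereDense (e '' (Submonoid.closure (range a) : Submonoid R)) := by
  have : FiniteDimensional ℝ R := e.symm.finiteDimensional
  have : Nontrivial R := e.toEquiv.nontrivial
  let h : R ≃ₜ E := e.toContinuousLinearEquiv.toHomeomorph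
  have hnd := isNowhereDense_closure_range (by rwa [e.finrank_eq]) a
  change interior (closure (h '' _)) = ∅
  rw [← h.image_closure, ← h.image_interior, image_eq_empty]
  exact hnd

-- Supplies `R` with a submultiplicative norm, induced from matrices; the conclusion sees only the
-- topology of `E`.
open scoped Matrix.Norms.Operator in
theorem isNowhereDense_linearEquiv_image_closure_range_of_injective {R E : Type*} [CommRing R]
    [Algebra ℝ R] {n : ℕ} (f : R →ₐ[ℝ] Matrix (Fin n) (Fin n) ℝ) (hf : Function.Injective f)
    [NormedAddCommGroup E] [NormedSpace ℝ E] [FiniteDimensional ℝ E]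
    [Nontrivial E] (e : R ≃ₗ[ℝ] E) {p : ℕ} (hp : 2 * p ≤ finrank ℝ E + 1) (a : Fin p → R) :
    IsNowhereDense (e '' (Submonoid.closure (range a) : Submonoid R)) :=
  letI : NormedCommRing R :=
    { NormedRing.induced R (Matrix (Fin n) (Fin n) ℝ) f hf with mul_comm := mul_comm }
  letI : NormedAlgebra ℝ R := NormedAlgebra.induced ℝ R (Matrix (Fin n) (Fin n) ℝ) f
  isNowhereDense_linearEquiv_image_closure_range e hp a

theorem isNowhereDense_mulVec_image_closure_range {R : Type*} [CommRing R] [Algebra ℝ R] {n : ℕ}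
    (hn : 1 ≤ n) (f : R →ₐ[ℝ] Matrix (Fin n) (Fin n) ℝ) (hf : Function.Injective f)
    (v : Fin n → ℝ) {p : ℕ} (hp : p ≤ (n + 1) / 2) (a : Fin p → R) :
    IsNowhereDense ((fun x => (f x).mulVec v) '' (Submonoid.closure (range a) : Submonoid R)) := by
  let ev : R →ₗ[ℝ] (Fin n → ℝ) :=
    { toFun := fun x => (f x).mulVec v
      map_add' := fun x y => by rw [map_add, Matrix.add_mulVec]
      map_smul' := fun c x => by rw [map_smul, Matrix.smul_mulVec, RingHom.id_apply] }
  rw [IsNowhereDense, ← not_nonempty_iff_eq_empty]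
  intro hne
  have hsurj : LinearMap.range ev = ⊤ := by
    refine Submodule.eq_top_of_nonempty_interior' _ (hne.mono (interior_mono ?_))
    exact closure_minimal (by rintro _ ⟨x, -, rfl⟩; exact ⟨x, rfl⟩)
      (Submodule.closed_of_finiteDimensional _)
  -- If `x` kills `v`, it kills every vector `y v`, because `x y v = y x v`; these are all vectors.
  have hinj : LinearMap.ker ev = ⊥ := by
    rw [LinearMap.ker_eq_bot']
    intro x hx
    refine hf (Matrix.mulVec_injective (funext fun w => ?_))
    obtain ⟨y, rfl⟩ := LinearMap.range_eq_top.1 hsurj w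
    have h1 : (f x).mulVec v = 0 := hx
    change (f x).mulVec ((f y).mulVec v) = _
    rw [Matrix.mulVec_mulVec, ← map_mul, mul_comm, map_mul, ← Matrix.mulVec_mulVec, h1]
    simp
  have : Nonempty (Fin n) := ⟨⟨0, hn⟩⟩
  exact hne.ne_empty (isNowhereDense_linearEquiv_image_closure_range_of_injective f hf
    (LinearEquiv.ofBijective ev ⟨LinearMap.ker_eq_bot.1 hinj, LinearMap.range_eq_top.1 hsurj⟩)
    (by rw [finrank_fin_fun]; omega) a)

/-- The orbits of an abelian matrix semigroup with at most `[(n + 1) / 2]` generators are nowhere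
dense. -/
theorem isNowhereDense_image_closure_range {n : ℕ} (hn : 1 ≤ n) {p : ℕ} (hp : p ≤ (n + 1) / 2)
    (A : Fin p → Matrix (Fin n) (Fin n) ℝ) (hA : ∀ i j, A i * A j = A j * A i) (v : Fin n → ℝ) :
    IsNowhereDense ((fun M : Matrix (Fin n) (Fin n) ℝ => M.mulVec v) ''
      (Submonoid.closure (range A) : Submonoid (Matrix (Fin n) (Fin n) ℝ))) := by
  obtain ⟨S, hS, hmem⟩ : ∃ S : Subalgebra ℝ (Matrix (Fin n) (Fin n) ℝ),
      (∀ x y : S, x * y = y * x) ∧ ∀ i, A i ∈ S :=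
    ⟨Algebra.adjoin ℝ (range A), (Algebra.isMulCommutative_adjoin ℝ (by
      rintro _ ⟨i, rfl⟩ _ ⟨j, rfl⟩; exact hA i j)).is_comm.comm,
      fun i => Algebra.subset_adjoin ⟨i, rfl⟩⟩
  let : CommRing S := { S.toRing with mul_comm := hS }
  let a : Fin p → S := fun i => ⟨A i, hmem i⟩
  have h1 : range A = S.val '' range a := by rw [← range_comp]; rfl
  have h2 : Submonoid.closure (range A) = (Submonoid.closure (range a)).map S.val := by
    rw [MonoidHom.map_mclosure, h1]
  rw [h2, Submonoid.coe_map, image_image]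
  exact isNowhereDense_mulVec_image_closure_range hn S.val Subtype.val_injective v hp a

theorem corollary1p6 (n : ℕ) (hn : 1 ≤ n) (p : ℕ) (hp : p ≤ (n + 1) / 2)
    (A : Fin p → Matrix (Fin n) (Fin n) ℝ)
    (G : Subsemigroup (Matrix (Fin n) (Fin n) ℝ))
    (hG : MatrixSemigroup.IsGeneratedBy G A) (hab : MatrixSemigroup.IsAbelian G) :
    (∀ v : Fin n → ℝ, IsNowhereDense (MatrixSemigroup.orbit G v)) ∧
      ¬ MatrixSemigroup.IsLocallyHypercyclic G ∧
      ¬ MatrixSemigroup.IsHypercyclic G := by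
  have hAG : ∀ i, A i ∈ G := fun i => by
    rcases hG with rfl | rfl
    · exact Subsemigroup.subset_closure ⟨i, rfl⟩
    · exact Submonoid.subset_closure ⟨i, rfl⟩
  have hGle : ∀ M ∈ G, M ∈ Submonoid.closure (range A) := fun M hM => by
    rcases hG with rfl | rfl
    · exact (Subsemigroup.closure_le (S := (Submonoid.closure (range A)).toSubsemigroup)).2
        Submonoid.subset_closure hM
    · exact hM
  have hnd : ∀ v : Fin n → ℝ, IsNowhereDense (MatrixSemigroup.orbit G v) := fun v =>
    (isNowhereDense_image_closure_range hn hp A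
      (fun i j => hab _ (hAG i) _ (hAG j)) v).mono (by
        rintro _ ⟨M, hM, rfl⟩
        exact ⟨M, hGle M hM, rfl⟩)
  refine ⟨hnd, ?_, ?_⟩
  · rintro ⟨v, hv⟩
    exact hv.ne_empty (hnd v)
  · rintro ⟨v, hv⟩
    have := hnd v
    rw [IsNowhereDense, hv.closure_eq, interior_univ] at this
    exact empty_ne_univ this.symm
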